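/- Let $\mathfrak X=\{X_1,\dots,X_n\}$ be smooth vector fields on $\mathbb R^n$, linearly independent at every point. Let $d$ be the Riemannian distance for which $\mathfrak X$ is an orthonormal frame: $d(x,y)$ is the infimum of $\int_0^1\|c(t)\|\,dt$ over $C^1$ curves $\gamma:[0,1]\to\mathbb R^n$ from $x$ to $y$ with $\gamma'(t)=\sum_i c_i(t)X_i(\gamma(t))$. Put $B_\rho(x_0)=\{y: d(x_0,y)<\rho\}$ and $D_{\mathfrak X}\varphi=(X_1\varphi,\dots,X_n\varphi)$, and let $(D^2_{\mathfrak X}\varphi)^\star$ be the matrix with entries $\frac12(X_iX_j\varphi+X_jX_i\varphi)$. Let $\Omega\subset\mathbb R^n$ be a bounded domain and let $\mathtt p\in C^1(\Omega)\cap W^{1,\infty}(\Omega)$ with $\mathtt p>1$ in $\Omega$. For a function $u:\Omega\to\mathbb R$ let $J^{2,+}_{\mathfrak X}u(x)$ be the set of pairs $(D_{\mathfrak X}\varphi(x),(D^2_{\mathfrak X}\varphi)^\star(x))$ where $\varphi$ is $C^2$ near $x$, $\varphi(x)=u(x)$ and $\varphi\ge u$ near $x$; let $J^{2,-}_{\mathfrak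 X}u(x)=-J^{2,+}_{\mathfrak X}(-u)(x)$; and let $\overline J^{2,\pm}_{\mathfrak X}u(x)$ be the set of limits of jets $(\eta_k,Y_k)\in J^{2,\pm}_{\mathfrak X}u(x_k)$ along sequences with $(x_k,u(x_k))\to(x,u(x))$. Write $$F(x,\eta,Y)=\langle Y\eta,\eta\rangle+\|\eta\|^2\langle\eta,D_{\mathfrak X}\ln \mathtt p(x)\rangle\ln\|\eta\|$$ (the last term being $0$ when $\eta=0$). The function $u$ is viscosity $\infty(x)$-harmonic in $\Omega$ if it is both upper and lower semicontinuous in $\Omega$ and, for every $x\in\Omega$, $-F(x,\eta,Y)\le 0$ for all $(\eta,Y)\in\overline J^{2,+}_{\mathfrak X}u(x)$ and $-F(x,\xi,Y)\ge 0$ for all $(\xi,Y)\in\overline J^{2,-}_{\mathfrak X}u(x)$. **Theorem 4.2 (Harnack inequality).** For every real $M$ there is a constant $C>0$, depending only on $\mathfrak X$, $\Omega$, $\mathtt p$ and $M$, such that for every positive viscosity $\infty(x)$-harmonic function $u$ in $\Omega$, every $x_0$ and every $r>0$ with $B_{2r}(x_0)\subset\Omega$ and $\sup_{B_{2r}(x_0)}u=M$,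 $$\sup_{B_r(x_0)}u\le C\Big(\inf_{B_r(x_0)}u+r\Big).$$ -/

import Mathlib

open Filter Topology
open scoped ContDiff

noncomputable section

namespace FrameHarnack

/-- The space `ℝⁿ` with its Euclidean structure. -/
abbrev Space (n : ℕ) : Type := EuclideanSpace ℝ (Fin n)

/-- A frame on `ℝⁿ`: `n` smooth vector fields `X i = ∑ j, a i j ∂ⱼ` that are linearly independent
at every point (equivalently, the matrix `(a i j) = (X i · j)` is invertible everywhere). The frame
is orthonormal for the Riemannian metric that it defines. -/
structure Frame (n : ℕ) where
  /-- the coefficient vector of the `i`-th vector field -/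
  field : Fin n → Space n → Space n
  /-- the vector fields are `C^∞` -/
  smooth : ∀ i, ContDiff ℝ ∞ (field i)
  /-- the vector fields are linearly independent at every point -/
  indep : ∀ x, LinearIndependent ℝ (fun i => field i x)

variable {n : ℕ}

namespace Frame

/-- The derivative `X_i u` of a function along the `i`-th vector field. -/
def deriv (X : Frame n) (i : Fin n) (u : Space n → ℝ) (x : Space n) : ℝ :=
  fderiv ℝ u x (X.field i x)

/-- The natural gradient `D_X u = (X_1 u, …, X_n u)`. -/
def grad (X : Frame n) (u : Space n → ℝ) (x : Space n) : Space n :=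
  WithLp.toLp 2 (fun i => X.deriv i u x)

/-- The symmetrized second derivative matrix, with entries `(X_i (X_j u) + X_j (X_i u)) / 2`. -/
def symHess (X : Frame n) (u : Space n → ℝ) (x : Space n) : Matrix (Fin n) (Fin n) ℝ :=
  Matrix.of fun i j => (1 / 2 : ℝ) * (X.deriv i (X.deriv j u) x + X.deriv j (X.deriv i u) x)

/-- `γ : [0,1] → ℝⁿ` is a `C¹` curve from `x` to `y` whose velocity is
`γ'(t) = ∑ i, c t i • X_i (γ t)`. -/
def IsCurve (X : Frame n) (x y : Space n) (γ c : ℝ → Space n) : Prop :=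
  γ 0 = x ∧ γ 1 = y ∧ ContinuousOn c (Set.Icc 0 1) ∧
    ∀ t ∈ Set.Icc (0 : ℝ) 1,
      HasDerivWithinAt γ (∑ i, c t i • X.field i (γ t)) (Set.Icc 0 1) t

/-- The distance `d(x,y)`: the infimum of the lengths of the curves from `x` to `y`, the length
of `γ' = ∑ i, c i • X_i` being measured with `X_1, …, X_n` orthonormal. -/
def dist (X : Frame n) (x y : Space n) : ℝ :=
  sInf {l : ℝ | ∃ γ c : ℝ → Space n, X.IsCurve x y γ c ∧ l = ∫ t in (0 : ℝ)..1, ‖c t‖}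

/-- The open ball of the distance `d`. -/
def ball (X : Frame n) (x : Space n) (r : ℝ) : Set (Space n) :=
  {y | X.dist x y < r}

/-- The second order superjet `J_X^{2,+} u(x)`: the pairs (gradient, symmetrized second derivative)
at `x` of the functions `φ` that are `C²` near `x` and touch `u` from above at `x`. -/
def superjet (X : Frame n) (u : Space n → ℝ) (x : Space n) :
    Set (Space n × Matrix (Fin n) (Fin n) ℝ) :=
  {q | ∃ φ : Space n → ℝ, ContDiffAt ℝ 2 φ x ∧ φ x = u x ∧ (∀ᶠ y in 𝓝 x, u y ≤ φ y) ∧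
    q = (X.grad φ x, X.symHess φ x)}

/-- The second order subjet `J_X^{2,-} u(x) = - J_X^{2,+} (-u)(x)`. -/
def subjet (X : Frame n) (u : Space n → ℝ) (x : Space n) :
    Set (Space n × Matrix (Fin n) (Fin n) ℝ) :=
  {q | -q ∈ X.superjet (fun y => -u y) x}

end Frame

/-- The set-theoretic closure of a family of jets `J` of `u`: the limits of jets `q k ∈ J (z k)`
along sequences with `z k → x` and `u (z k) → u x`. -/
def jetClosure (J : Space n → Set (Space n × Matrix (Fin n) (Fin n) ℝ))
    (u : Space n → ℝ) (x : Space n) : Set (Space n × Matrix (Fin n) (Fin n) ℝ) :=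
  {q | ∃ (z : ℕ → Space n) (w : ℕ → Space n × Matrix (Fin n) (Fin n) ℝ),
    (∀ k, w k ∈ J (z k)) ∧ Tendsto z atTop (𝓝 x) ∧
      Tendsto (fun k => u (z k)) atTop (𝓝 (u x)) ∧ Tendsto w atTop (𝓝 q)}

namespace Frame

/-- The `∞(x)`-Laplacian on a jet `q = (η, Y)` at `x`:
`⟨Y η, η⟩ + ‖η‖² ⟨η, D_X ln p (x)⟩ ln ‖η‖`, where the last term is `0` for `η = 0`. -/
def infLaplace (X : Frame n) (p : Space n → ℝ) (x : Space n)
    (q : Space n × Matrix (Fin n) (Fin n) ℝ) : ℝ :=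
  dotProduct (Matrix.mulVec q.2 q.1.ofLp) q.1.ofLp
    + ‖q.1‖ ^ 2 * inner ℝ q.1 (X.grad (fun y => Real.log (p y)) x) * Real.log ‖q.1‖

/-- Real-valued viscosity `∞(x)`-subharmonic functions in `Ω`. (Being real-valued, they are not
identically `-∞` on any component.) For open `Ω` only the values of `u` on `Ω` matter. -/
def IsSubharmonic (X : Frame n) (p : Space n → ℝ) (Ω : Set (Space n)) (u : Space n → ℝ) : Prop :=
  UpperSemicontinuousOn u Ω ∧
    ∀ x ∈ Ω, ∀ q ∈ jetClosure (X.superjet u) u x, -X.infLaplace p x q ≤ 0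

/-- Real-valued viscosity `∞(x)`-superharmonic functions in `Ω`. -/
def IsSuperharmonic (X : Frame n) (p : Space n → ℝ) (Ω : Set (Space n)) (u : Space n → ℝ) : Prop :=
  LowerSemicontinuousOn u Ω ∧
    ∀ x ∈ Ω, ∀ q ∈ jetClosure (X.subjet u) u x, 0 ≤ -X.infLaplace p x q

/-- Viscosity `∞(x)`-harmonic functions in `Ω`. Such a function is real-valued, since an upper
semicontinuous function omits the value `∞` and a lower semicontinuous one omits `-∞`. -/
def IsHarmonic (X : Frame n) (p : Space n → ℝ) (Ω : Set (Space n)) (u : Space n → ℝ) : Prop :=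
  X.IsSubharmonic p Ω u ∧ X.IsSuperharmonic p Ω u

/-- The exponents: `1 < p ∈ C¹(Ω) ∩ W^{1,∞}(Ω)`. For a `C¹` function on an open set the weak
gradient is the classical one, and membership in `W^{1,∞}` means that the function and
its gradient are bounded. -/
def IsExponent (X : Frame n) (Ω : Set (Space n)) (p : Space n → ℝ) : Prop :=
  ContDiffOn ℝ 1 p Ω ∧ (∀ x ∈ Ω, 1 < p x) ∧ ∃ K : ℝ, ∀ x ∈ Ω, |p x| ≤ K ∧ ‖X.grad p x‖ ≤ K

end Frame

/-- Bounded domains: non-empty, open, connected, bounded sets. -/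
def IsBoundedDomain (Ω : Set (Space n)) : Prop :=
  IsOpen Ω ∧ IsConnected Ω ∧ Bornology.IsBounded Ω

end FrameHarnack

end

noncomputable section

namespace FrameHarnack

variable {n : ℕ}

namespace Frame

/-! The barrier is a concave cone `s (ρ - l ρ²)` with vertex `y`, where `ρ` is the norm of `x - y`
in the metric frozen at `y`. For a constant frame and a constant exponent, the curvature `l` alone
makes `F` negative on its jet. A variable frame and the logarithmic term add errors of the same
order in `ρ` as this gain, so `F` stays negative once `l` exceeds a constant multiple of `1 + B log
s`, where `B` bounds `D_X ln p` (`infLaplace_cone_neg`).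

A superharmonic `u` therefore cannot be touched from below by a reflected cone away from the vertex.
With `s = 2 (u y + r) / R`, the cone exceeds `u y` on the boundary of the ellipsoid `ρ ≤ R`, so `u y
≤ u + cone` inside. On the ellipsoid of radius `R / 4` this says that `u + r` drops by at most a
factor 2 (`half_le_of_isSuperharmonic`). The summand `r` keeps `s ≥ 4`, which controls the sign of
the logarithm.

For `R` comparable to `r`, the curvature grows like `log (1 / r)`, with constants that depend on
`M`. The requirement `l R ≤ 1 / 4` holds for small `r` because `r log r → 0`. A curve of length less
than `r` is covered by a number of steps independent of `r` (`harnack_chain`), which compares each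
point with the centre. For `r` above the threshold `r₀`, the bound `u ≤ M` and the summand `r`
suffice. -/

/-! ### The frame as an invertible matrix field, and its bounds on compact sets. -/

/-- The linear map `c ↦ ∑ i, c i • X_i x` that the frame defines at `x`. -/
def synth (X : Frame n) (x : Space n) : Space n →L[ℝ] Space n :=
  ∑ i, (EuclideanSpace.proj i : Space n →L[ℝ] ℝ).smulRight (X.field i x)

theorem synth_apply (X : Frame n) (x c : Space n) :
    X.synth x c = ∑ i, c i • X.field i x := by
  simp [synth]

theorem continuous_synth (X : Frame n) : Continuous X.synth := by
  unfold synth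
  refine continuous_finsetSum _ fun i _ => ?_
  have h : Continuous fun x => ContinuousLinearMap.smulRightL ℝ (Space n) (Space n)
      (EuclideanSpace.proj i) (X.field i x) :=
    (ContinuousLinearMap.continuous _).comp (X.smooth i).continuous
  exact h

theorem isUnit_synth (X : Frame n) (x : Space n) : IsUnit (X.synth x) := by
  have hinj : Function.Injective (X.synth x : Space n →ₗ[ℝ] Space n) := by
    rw [← LinearMap.ker_eq_bot, LinearMap.ker_eq_bot']
    intro c hc
    have h1 : ∑ i, c i • X.field i x = 0 := by rw [← synth_apply]; exact hc
    have h2 := Fintype.linearIndependent_iff.1 (X.indep x) (fun i => c i) h1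
    ext i
    exact h2 i
  exact ContinuousLinearMap.isUnit_iff_isUnit_toLinearMap.2
    ((LinearMap.isUnit_iff_ker_eq_bot _).2 (LinearMap.ker_eq_bot.2 hinj))

/-- The inverse of `synth`: the components of a vector in the frame at `x`. -/
def coframe (X : Frame n) (x : Space n) : Space n →L[ℝ] Space n :=
  Ring.inverse (X.synth x)

theorem synth_coframe (X : Frame n) (x v : Space n) : X.synth x (X.coframe x v) = v := by
  have h := Ring.mul_inverse_cancel _ (X.isUnit_synth x)
  exact congrArg (fun T : Space n →L[ℝ] Space n => T v) h

theorem coframe_synth (X : Frame n) (x v : Space n) : X.coframe x (X.synth x v) = v := by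
  have h := Ring.inverse_mul_cancel _ (X.isUnit_synth x)
  exact congrArg (fun T : Space n →L[ℝ] Space n => T v) h

theorem continuous_coframe (X : Frame n) : Continuous X.coframe := by
  rw [continuous_iff_continuousAt]
  intro x
  obtain ⟨U, hU⟩ := X.isUnit_synth x
  have h := NormedRing.inverse_continuousAt U
  rw [hU] at h
  exact h.comp X.continuous_synth.continuousAt

/-- `a` bounds the frame, its inverse, and their moduli of continuity on `K`. -/
structure Bounds (X : Frame n) (K : Set (Space n)) (a : ℝ) : Prop where
  one_le : 1 ≤ a
  synth_le : ∀ x ∈ K, ∀ c, ‖X.synth x c‖ ≤ a * ‖c‖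
  coframe_le : ∀ x ∈ K, ∀ c, ‖X.coframe x c‖ ≤ a * ‖c‖
  sub_le : ∀ x ∈ K, ∀ y ∈ K, ∀ c, ‖X.synth x c - X.synth y c‖ ≤ a * ‖x - y‖ * ‖c‖
  fderiv_le : ∀ x ∈ K, ∀ c v : Space n, ‖∑ i, c i • fderiv ℝ (X.field i) x v‖ ≤ a * ‖c‖ * ‖v‖

theorem norm_sum_smul_le {c : Space n} {w : Fin n → Space n} {B : ℝ} (hw : ∀ i, ‖w i‖ ≤ B) :
    ‖∑ i, c i • w i‖ ≤ n * ‖c‖ * B := by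
  calc ‖∑ i, c i • w i‖ ≤ ∑ i : Fin n, ‖c‖ * B := by
        refine norm_sum_le_of_le _ fun i _ => ?_
        rw [norm_smul]
        gcongr
        · exact PiLp.norm_apply_le c i
        · exact hw i
    _ = n * ‖c‖ * B := by simp; ring

/-- Compactness gives the bounds. The Lipschitz estimate is the mean value inequality, which needs
the convexity of the ball; this is why `Ω` is replaced by a ball around it. -/
theorem exists_bounds (X : Frame n) (R : ℝ) : ∃ a, X.Bounds (Metric.closedBall 0 R) a := by
  have hK : IsCompact (Metric.closedBall (0 : Space n) R) := isCompact_closedBall _ _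
  obtain ⟨a₁, h₁⟩ := hK.exists_bound_of_continuousOn X.continuous_synth.continuousOn
  obtain ⟨a₂, h₂⟩ := hK.exists_bound_of_continuousOn X.continuous_coframe.continuousOn
  have h₃ : ∀ i, ∃ a, ∀ x ∈ Metric.closedBall (0 : Space n) R, ‖fderiv ℝ (X.field i) x‖ ≤ a :=
    fun i => hK.exists_bound_of_continuousOn
      ((X.smooth i).continuous_fderiv (by simp)).continuousOn
  choose a₃ h₃ using h₃
  set B := ∑ i, |a₃ i| with hB
  have hB0 : 0 ≤ B := Finset.sum_nonneg fun i _ => abs_nonneg _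
  have h₄ : ∀ i, ∀ x ∈ Metric.closedBall (0 : Space n) R, ‖fderiv ℝ (X.field i) x‖ ≤ B :=
    fun i x hx => (h₃ i x hx).trans ((le_abs_self _).trans
      (Finset.single_le_sum (f := fun i => |a₃ i|) (fun i _ => abs_nonneg _) (Finset.mem_univ i)))
  have hnB : 0 ≤ n * B := by positivity
  refine ⟨1 + |a₁| + |a₂| + n * B, ⟨?_, ?_, ?_, ?_, ?_⟩⟩
  · linarith [abs_nonneg a₁, abs_nonneg a₂]
  · intro x hx c
    refine ((X.synth x).le_of_opNorm_le (h₁ x hx) c).trans ?_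
    gcongr
    linarith [abs_nonneg a₂, le_abs_self a₁]
  · intro x hx c
    refine ((X.coframe x).le_of_opNorm_le (h₂ x hx) c).trans ?_
    gcongr
    linarith [abs_nonneg a₁, le_abs_self a₂]
  · intro x hx y hy c
    have h := norm_sum_smul_le (c := c) (w := fun i => X.field i x - X.field i y)
      (B := B * ‖x - y‖) fun i =>
      (convex_closedBall (0 : Space n) R).norm_image_sub_le_of_norm_fderiv_le
        (fun z _ => ((X.smooth i).differentiable (by simp)).differentiableAt)
        (fun z hz => h₄ i z hz) hy hx
    rw [synth_apply, synth_apply, ← Finset.sum_sub_distrib]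
    simp only [← smul_sub]
    refine h.trans ?_
    have : n * ‖c‖ * (B * ‖x - y‖) = (n * B) * ‖x - y‖ * ‖c‖ := by ring
    rw [this]
    gcongr
    linarith [abs_nonneg a₁, abs_nonneg a₂]
  · intro x hx c v
    have h := norm_sum_smul_le (c := c) (w := fun i => fderiv ℝ (X.field i) x v)
      (B := B * ‖v‖) fun i => (fderiv ℝ (X.field i) x).le_of_opNorm_le (h₄ i x hx) v
    refine h.trans ?_
    have : n * ‖c‖ * (B * ‖v‖) = (n * B) * ‖c‖ * ‖v‖ := by ring
    rw [this]
    gcongr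
    linarith [abs_nonneg a₁, abs_nonneg a₂]

/-! ### Curves -/

theorem IsCurve.continuousOn {X : Frame n} {x y : Space n} {γ c : ℝ → Space n}
    (h : X.IsCurve x y γ c) : ContinuousOn γ (Set.Icc 0 1) :=
  fun t ht => (h.2.2.2 t ht).continuousWithinAt

/-- A `C¹` curve is a curve of the frame, its velocity having components given by `coframe`. -/
theorem isCurve_coframe (X : Frame n) {γ γ' : ℝ → Space n}
    (hγ' : ContinuousOn γ' (Set.Icc 0 1))
    (hγ : ∀ t ∈ Set.Icc (0 : ℝ) 1, HasDerivWithinAt γ (γ' t) (Set.Icc 0 1) t) :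
    X.IsCurve (γ 0) (γ 1) γ (fun t => X.coframe (γ t) (γ' t)) := by
  refine ⟨rfl, rfl, ?_, fun t ht => ?_⟩
  · have h1 : ContinuousOn γ (Set.Icc 0 1) := fun t ht => (hγ t ht).continuousWithinAt
    exact (X.continuous_coframe.comp_continuousOn h1).clm_apply hγ'
  · rw [← synth_apply, synth_coframe]
    exact hγ t ht

/-- The segment shows that the set of lengths in `dist` is never empty, so its `sInf` is a true
infimum and not the default value 0. -/
theorem exists_isCurve (X : Frame n) (x y : Space n) : ∃ γ c, X.IsCurve x y γ c := by
  have h := X.isCurve_coframe (γ := fun t => x + t • (y - x)) (γ' := fun _ => y - x)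
    continuousOn_const (fun t _ => by
      have := ((hasDerivAt_id t).smul_const (y - x)).const_add x
      simpa using this.hasDerivWithinAt)
  simp only [zero_smul, add_zero, one_smul, add_sub_cancel] at h
  exact ⟨_, _, h⟩

theorem dist_le (X : Frame n) {x y : Space n} {γ c : ℝ → Space n} (h : X.IsCurve x y γ c) :
    X.dist x y ≤ ∫ t in (0 : ℝ)..1, ‖c t‖ := by
  refine csInf_le ⟨0, ?_⟩ ⟨γ, c, h, rfl⟩
  rintro l ⟨γ, c, -, rfl⟩
  exact intervalIntegral.integral_nonneg zero_le_one fun t _ => norm_nonneg _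

theorem exists_isCurve_of_mem_ball (X : Frame n) {x y : Space n} {r : ℝ} (h : y ∈ X.ball x r) :
    ∃ γ c, X.IsCurve x y γ c ∧ ∫ t in (0 : ℝ)..1, ‖c t‖ < r := by
  obtain ⟨γ, c, hγ⟩ := X.exists_isCurve x y
  obtain ⟨l, ⟨γ, c, hc, rfl⟩, hl⟩ :=
    exists_lt_of_csInf_lt (s := {l : ℝ | ∃ γ c : ℝ → Space n, X.IsCurve x y γ c ∧
      l = ∫ t in (0 : ℝ)..1, ‖c t‖}) ⟨_, γ, c, hγ, rfl⟩ h
  exact ⟨γ, c, hc, hl⟩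

theorem mem_ball_self (X : Frame n) (x : Space n) {r : ℝ} (hr : 0 < r) : x ∈ X.ball x r := by
  have h : X.IsCurve x x (fun _ => x) (fun _ => 0) :=
    ⟨rfl, rfl, continuousOn_const, fun t _ => by simpa using hasDerivWithinAt_const t _ x⟩
  exact lt_of_le_of_lt (by simpa using X.dist_le h) hr

theorem ball_mono (X : Frame n) (x : Space n) {r s : ℝ} (h : r ≤ s) : X.ball x r ⊆ X.ball x s :=
  fun _ hy => lt_of_lt_of_le hy h

theorem IsCurve.restrict {X : Frame n} {x y : Space n} {γ c : ℝ → Space n}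
    (h : X.IsCurve x y γ c) {T : ℝ} (hT : T ∈ Set.Icc (0 : ℝ) 1) :
    X.IsCurve x (γ T) (fun t => γ (T * t)) (fun t => T • c (T * t)) := by
  have hmaps : Set.MapsTo (fun t => T * t) (Set.Icc (0 : ℝ) 1) (Set.Icc 0 1) := fun t ht =>
    ⟨mul_nonneg hT.1 ht.1, mul_le_one₀ hT.2 ht.1 ht.2⟩
  refine ⟨by simpa using h.1, by simp, ?_, fun t ht => ?_⟩
  · exact (h.2.2.1.comp (by fun_prop) hmaps).const_smul T
  · have h1 := h.2.2.2 _ (hmaps ht)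
    have h2 : HasDerivWithinAt (fun t => T * t) T (Set.Icc 0 1) t := by
      simpa using ((hasDerivAt_id t).const_mul T).hasDerivWithinAt
    have h3 := h1.scomp t h2 hmaps
    simpa [Function.comp_def, Finset.smul_sum, smul_smul] using h3

theorem IsCurve.mem_ball {X : Frame n} {x y : Space n} {γ c : ℝ → Space n} {r : ℝ}
    (h : X.IsCurve x y γ c) (hl : ∫ t in (0 : ℝ)..1, ‖c t‖ < r) {T : ℝ}
    (hT : T ∈ Set.Icc (0 : ℝ) 1) : γ T ∈ X.ball x r := by
  refine lt_of_le_of_lt (X.dist_le (h.restrict hT)) (lt_of_le_of_lt ?_ hl)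
  have h1 : ∫ t in (0 : ℝ)..1, ‖T • c (T * t)‖ = ∫ t in (0 : ℝ)..T, ‖c t‖ := by
    simp only [norm_smul, intervalIntegral.integral_const_mul, Real.norm_of_nonneg hT.1]
    simpa using intervalIntegral.mul_integral_comp_mul_left (a := 0) (b := 1) (f := fun t => ‖c t‖) T
  rw [h1]
  refine intervalIntegral.integral_mono_interval le_rfl hT.1 hT.2
    (Eventually.of_forall fun t => norm_nonneg _) ?_
  exact (ContinuousOn.norm (by simpa using h.2.2.1)).intervalIntegrable

/-- A curve `γ` from `x` to `y` is sheared to `γ t + t • (z - y)`, which ends at `z` and is still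
`C¹`, as a concatenation need not be. Its length is at most `3/2` of the old one plus `r / 2`. This
keeps the ellipsoids around points of a ball inside the doubled ball. -/
theorem mem_ball_of_norm_sub_le {X : Frame n} {K Ω : Set (Space n)} {a r : ℝ} (hK : X.Bounds K a)
    {x y z : Space n} (hΩ : X.ball x r ⊆ Ω)
    (hΩK : ∀ p ∈ Ω, ∀ v : Space n, ‖v‖ ≤ 1 → p + v ∈ K) (hy : y ∈ X.ball x r)
    (h1 : ‖z - y‖ ≤ 1) (h2 : a ^ 2 * ‖z - y‖ ≤ 1 / 2) (h3 : a * ‖z - y‖ ≤ r / 2) :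
    z ∈ X.ball x (2 * r) := by
  obtain ⟨γ, c, hγ, hl⟩ := X.exists_isCurve_of_mem_ball hy
  have ha := hK.one_le
  have hγd : ∀ t ∈ Set.Icc (0 : ℝ) 1, HasDerivWithinAt (fun t => γ t + t • (z - y))
      (X.synth (γ t) (c t) + (z - y)) (Set.Icc 0 1) t := fun t ht => by
    have e1 := hγ.2.2.2 t ht
    rw [← synth_apply] at e1
    have e2 := ((hasDerivAt_id t).smul_const (z - y)).hasDerivWithinAt (s := Set.Icc 0 1)
    rw [one_smul] at e2
    exact e1.add e2
  have hcont : ContinuousOn (fun t => X.synth (γ t) (c t) + (z - y)) (Set.Icc 0 1) :=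
    ((X.continuous_synth.comp_continuousOn hγ.continuousOn).clm_apply hγ.2.2.1).add
      continuousOn_const
  have hc := X.isCurve_coframe hcont hγd
  have e0 : γ 0 + (0 : ℝ) • (z - y) = x := by simp [hγ.1]
  have e1 : γ 1 + (1 : ℝ) • (z - y) = z := by simp [hγ.2.1]
  rw [e0, e1] at hc
  have hint : IntervalIntegrable (fun t => ‖c t‖) MeasureTheory.volume 0 1 :=
    (ContinuousOn.norm (by simpa using hγ.2.2.1)).intervalIntegrable
  have hle : ∫ t in (0 : ℝ)..1, ‖X.coframe (γ t + t • (z - y)) (X.synth (γ t) (c t) + (z - y))‖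
      ≤ ∫ t in (0 : ℝ)..1, (3 / 2 * ‖c t‖ + r / 2) := by
    refine intervalIntegral.integral_mono_on zero_le_one
      (ContinuousOn.norm (by simpa using hc.2.2.1)).intervalIntegrable
      ((hint.const_mul _).add intervalIntegrable_const) fun t ht => ?_
    have htn : ‖t • (z - y)‖ ≤ ‖z - y‖ := by
      rw [norm_smul, Real.norm_of_nonneg ht.1]
      exact mul_le_of_le_one_left (norm_nonneg _) ht.2
    have hm : γ t ∈ Ω := hΩ (hγ.mem_ball hl ht)
    have k1 : γ t ∈ K := by simpa using hΩK _ hm 0 (by simp)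
    have k2 : γ t + t • (z - y) ∈ K := hΩK _ hm _ (htn.trans h1)
    set q := γ t + t • (z - y)
    have hq : ‖γ t - q‖ ≤ ‖z - y‖ := by simpa [q] using htn
    -- The components at the shifted point `q` differ from `c t` by the change of the frame from `γ
    -- t` to `q` and by the added velocity `z - y`.
    have hsplit : X.coframe q (X.synth (γ t) (c t) + (z - y)) =
        c t + X.coframe q (X.synth (γ t) (c t) - X.synth q (c t)) + X.coframe q (z - y) := by
      rw [map_add, map_sub (X.coframe q) (X.synth (γ t) (c t)), coframe_synth]; abel
    rw [hsplit]
    have b1 : ‖X.coframe q (X.synth (γ t) (c t) - X.synth q (c t))‖ ≤ 1 / 2 * ‖c t‖ :=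
      calc _ ≤ a * (a * ‖γ t - q‖ * ‖c t‖) := (hK.coframe_le q k2 _).trans (by
              gcongr; exact hK.sub_le _ k1 _ k2 _)
        _ ≤ a * (a * ‖z - y‖ * ‖c t‖) := by gcongr
        _ = a ^ 2 * ‖z - y‖ * ‖c t‖ := by ring
        _ ≤ 1 / 2 * ‖c t‖ := by gcongr
    have b2 : ‖X.coframe q (z - y)‖ ≤ r / 2 := (hK.coframe_le q k2 _).trans h3
    linarith [norm_add₃_le (a := c t) (b := X.coframe q (X.synth (γ t) (c t) - X.synth q (c t)))
      (c := X.coframe q (z - y))]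
  have hval : ∫ t in (0 : ℝ)..1, (3 / 2 * ‖c t‖ + r / 2) =
      3 / 2 * (∫ t in (0 : ℝ)..1, ‖c t‖) + r / 2 := by
    rw [intervalIntegral.integral_add (hint.const_mul _) intervalIntegrable_const,
      intervalIntegral.integral_const_mul]
    simp
  exact lt_of_le_of_lt ((X.dist_le hc).trans hle) (by rw [hval]; linarith)

/-! ### Jets of the cone barriers. -/

/-- The quadratic form of the symmetrized second derivative, as derivatives of the `X_j u` in the
direction `∑ i, c i • X_i`. -/
theorem dotProduct_symHess (X : Frame n) (u : Space n → ℝ) (x c : Space n) :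
    dotProduct (Matrix.mulVec (X.symHess u x) c.ofLp) c.ofLp =
      ∑ j, c j * fderiv ℝ (X.deriv j u) x (X.synth x c) := by
  have h1 : ∀ j, fderiv ℝ (X.deriv j u) x (X.synth x c) =
      ∑ i, c i * X.deriv i (X.deriv j u) x := fun j => by
    simp [synth_apply, deriv]
  simp only [h1, dotProduct, Matrix.mulVec, symHess, Matrix.of_apply, Finset.sum_mul,
    Finset.mul_sum]
  -- Both orders of differentiation give the same quadratic form, so the symmetrization is harmless.
  have h2 : ∑ x_1 : Fin n, ∑ i : Fin n, c x_1 * (c i * X.deriv i (X.deriv x_1 u) x) =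
    ∑ x_1 : Fin n, ∑ i : Fin n, c x_1 * (c i * X.deriv x_1 (X.deriv i u) x) := by
    rw [Finset.sum_comm]
    refine Finset.sum_congr rfl fun i _ => Finset.sum_congr rfl fun j _ => by ring
  have h3 : ∀ a b : ℝ, a = b → 1 / 2 * (a + b) = a := fun a b h => by linarith
  rw [← h3 _ _ h2, ← Finset.sum_add_distrib, Finset.mul_sum]
  refine Finset.sum_congr rfl fun i _ => ?_
  rw [← Finset.sum_add_distrib, Finset.mul_sum]
  refine Finset.sum_congr rfl fun j _ => by ring

theorem norm_grad_log_le {X : Frame n} {p : Space n → ℝ} {x : Space n} {B : ℝ}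
    (hd : DifferentiableAt ℝ p x) (hp : 1 < p x) (hB : ‖X.grad p x‖ ≤ B) :
    ‖X.grad (fun y => Real.log (p y)) x‖ ≤ B := by
  have h : X.grad (fun y => Real.log (p y)) x = (p x)⁻¹ • X.grad p x := by
    ext i
    simp [grad, deriv, fderiv.log hd (by linarith : p x ≠ 0)]
  rw [h, norm_smul, norm_inv, Real.norm_of_nonneg (by linarith)]
  exact (mul_le_of_le_one_left (norm_nonneg _) (inv_le_one_of_one_le₀ hp.le)).trans hB

/-- The concave cone with vertex `y`, slope `s` at the vertex and curvature `l`, where the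
distance to `y` is measured by the metric at `y`. -/
def cone (X : Frame n) (y : Space n) (s l : ℝ) (x : Space n) : ℝ :=
  s * (‖X.coframe y (x - y)‖ - l * ‖X.coframe y (x - y)‖ ^ 2)

theorem contDiffAt_cone (X : Frame n) {x y : Space n} (s l : ℝ) (hx : x ≠ y) :
    ContDiffAt ℝ 2 (X.cone y s l) x := by
  have h0 : X.coframe y (x - y) ≠ 0 := fun h => hx (by
    have := congrArg (X.synth y) h
    rwa [synth_coframe, map_zero, sub_eq_zero] at this)
  have h1 : ContDiffAt ℝ 2 (fun x => X.coframe y (x - y)) x :=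
    (X.coframe y).contDiff.contDiffAt.comp x (contDiffAt_id.sub contDiffAt_const)
  have h2 : ContDiffAt ℝ 2 (fun x => ‖X.coframe y (x - y)‖) x := h1.norm ℝ h0
  exact contDiffAt_const.mul (h2.sub (contDiffAt_const.mul (h2.pow 2)))

theorem hasFDerivAt_norm_coframe (X : Frame n) {x y : Space n} (hx : X.coframe y (x - y) ≠ 0) :
    HasFDerivAt (fun x => ‖X.coframe y (x - y)‖)
      (‖X.coframe y (x - y)‖⁻¹ • (innerSL ℝ (X.coframe y (x - y))).comp (X.coframe y)) x := by
  have h1 : HasFDerivAt (fun x => X.coframe y (x - y)) (X.coframe y) x := by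
    exact (X.coframe y).hasFDerivAt.comp x ((hasFDerivAt_id x).sub_const y)
  have h2 := h1.norm_sq
  have h3 := h2.sqrt (by positivity)
  simp only [Real.sqrt_sq (norm_nonneg _)] at h3
  have h4 : ‖X.coframe y (x - y)‖⁻¹ • (innerSL ℝ (X.coframe y (x - y))).comp (X.coframe y) =
      (1 / (2 * ‖X.coframe y (x - y)‖)) • 2 •
        (innerSL ℝ (X.coframe y (x - y))).comp (X.coframe y) := by
    ext v
    simp [-map_sub]
    ring
  rw [h4]
  exact h3

theorem deriv_cone (X : Frame n) {x y : Space n} (s l c : ℝ) (hx : X.coframe y (x - y) ≠ 0)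
    (i : Fin n) :
    X.deriv i (fun x => c + X.cone y s l x) x = s * (‖X.coframe y (x - y)‖⁻¹ - 2 * l) *
      inner ℝ (X.coframe y (x - y)) (X.coframe y (X.field i x)) := by
  have h1 := X.hasFDerivAt_norm_coframe hx
  have h2 := ((h1.sub ((h1.pow 2).const_mul l)).const_mul s).const_add c
  have h3 : HasFDerivAt (fun x => c + X.cone y s l x) _ x := h2
  have h0 : ‖X.coframe y (x - y)‖ ≠ 0 := norm_ne_zero_iff.2 hx
  rw [deriv, h3.fderiv]
  simp [-map_sub]
  field_simp

/-- The second derivatives of a cone. -/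
theorem fderiv_deriv_cone (X : Frame n) {x y : Space n} (s l c : ℝ)
    (hx : X.coframe y (x - y) ≠ 0) (i : Fin n) (v : Space n) :
    fderiv ℝ (X.deriv i (fun x => c + X.cone y s l x)) x v =
      -(s / ‖X.coframe y (x - y)‖ ^ 3 * inner ℝ (X.coframe y (x - y)) (X.coframe y v)) *
        inner ℝ (X.coframe y (x - y)) (X.coframe y (X.field i x)) +
      s * (‖X.coframe y (x - y)‖⁻¹ - 2 * l) *
        (inner ℝ (X.coframe y v) (X.coframe y (X.field i x)) +
          inner ℝ (X.coframe y (x - y)) (X.coframe y (fderiv ℝ (X.field i) x v))) := by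
  have h1 : HasFDerivAt (fun x => X.coframe y (x - y)) (X.coframe y) x := by
    exact (X.coframe y).hasFDerivAt.comp x ((hasFDerivAt_id x).sub_const y)
  have hev : ∀ᶠ z in 𝓝 x, X.deriv i (fun x => c + X.cone y s l x) z =
      s * (‖X.coframe y (z - y)‖⁻¹ - 2 * l) *
      inner ℝ (X.coframe y (z - y)) (X.coframe y (X.field i z)) := by
    filter_upwards [h1.continuousAt.eventually_ne hx] with z hz using X.deriv_cone s l c hz i
  have h0 : ‖X.coframe y (x - y)‖ ≠ 0 := norm_ne_zero_iff.2 hx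
  have h2 : HasFDerivAt (X.field i) (fderiv ℝ (X.field i) x) x :=
    (((X.smooth i).differentiable (by simp)) x).hasFDerivAt
  have h3 := (X.coframe y).hasFDerivAt.comp x h2
  have h4 := h1.inner ℝ h3
  have h5 := (hasDerivAt_inv h0).comp_hasFDerivAt x (X.hasFDerivAt_norm_coframe hx)
  have h6 := ((h5.sub_const (2 * l)).const_mul s).mul h4
  rw [Filter.EventuallyEq.fderiv_eq hev]
  have h7 := h6.fderiv
  simp only [Function.comp_def] at h7
  refine (congrArg (fun T => T v) h7).trans ?_
  simp [-map_sub]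
  field_simp
  ring

/-- With `A = coframe y ∘ synth x`, the vectors are `β = A* ξ` and `e = A β`. The three terms come
from differentiating the radial factor `h`, the vector `ξ`, and the fields `X_i` themselves. -/
theorem dotProduct_symHess_cone (X : Frame n) {x y : Space n} (s l c : ℝ)
    (hx : X.coframe y (x - y) ≠ 0) {ξ β e : Space n} {h : ℝ} (hξ : ξ = X.coframe y (x - y))
    (hβ : ∀ c, inner ℝ β c = inner ℝ ξ (X.coframe y (X.synth x c)))
    (he : e = X.coframe y (X.synth x β)) (hh : h = s * (‖ξ‖⁻¹ - 2 * l)) :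
    X.grad (fun x => c + X.cone y s l x) x = h • β ∧
    dotProduct (Matrix.mulVec (X.symHess (fun x => c + X.cone y s l x) x) (h • β).ofLp)
      (h • β).ofLp = h ^ 2 * (-(s / ‖ξ‖ ^ 3) * ‖β‖ ^ 4 + h * ‖e‖ ^ 2 +
        inner ℝ ξ (X.coframe y (∑ i, β i • fderiv ℝ (X.field i) x (X.synth x (h • β))))) := by
  have hβi : ∀ i, inner ℝ ξ (X.coframe y (X.field i x)) = β i := fun i => by
    have := hβ (EuclideanSpace.single i 1)
    rw [synth_apply] at this
    simpa [Pi.single_apply, ite_smul, EuclideanSpace.inner_single_right] using this.symm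
  have hβe : inner ℝ ξ e = ‖β‖ ^ 2 := by rw [he, ← hβ, real_inner_self_eq_norm_sq]
  refine ⟨?_, ?_⟩
  · ext i
    simp [grad, X.deriv_cone s l c hx, ← hξ, hβi, hh]
  · rw [dotProduct_symHess]
    simp only [X.fderiv_deriv_cone s l c hx, ← hξ, ← hh, hβi, map_smul, inner_smul_right,
      inner_smul_left, ← he, hβe]
    have e1 : ∑ i, β i * inner ℝ e (X.coframe y (X.field i x)) = ‖e‖ ^ 2 := by
      rw [← real_inner_self_eq_norm_sq e]
      nth_rw 3 [he]
      rw [synth_apply, map_sum, inner_sum]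
      simp [inner_smul_right]
    have e2 : ∑ i, β i * inner ℝ ξ (X.coframe y (fderiv ℝ (X.field i) x (X.synth x β))) =
        inner ℝ ξ (X.coframe y (∑ i, β i • fderiv ℝ (X.field i) x (X.synth x β))) := by
      rw [map_sum, inner_sum]
      simp [inner_smul_right]
    have e3 : ∑ i, β i * β i = ‖β‖ ^ 2 := by
      rw [← real_inner_self_eq_norm_sq, PiLp.inner_apply]; simp [sq]
    have e4 : X.coframe y (∑ i, β i • h • fderiv ℝ (X.field i) x (X.synth x β)) =
        h • X.coframe y (∑ i, β i • fderiv ℝ (X.field i) x (X.synth x β)) := by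
      simp only [smul_comm _ h, ← Finset.smul_sum, map_smul]
    rw [e4, inner_smul_right, ← e1, ← e2]
    have e5 : ‖β‖ ^ 4 = ‖β‖ ^ 2 * ∑ i, β i * β i := by rw [e3]; ring
    rw [e5]
    simp only [Finset.mul_sum, Finset.sum_add_distrib, mul_add]
    simp only [← Finset.sum_add_distrib]
    refine Finset.sum_congr rfl fun i _ => ?_
    simp
    ring

/-! ### Strict negativity of the operator on cones. -/

/-- In the geometry of the cones, the metric at the vertex is close to the metric at `x`. -/
theorem cone_geometry {ξ β e : Space n} {ρ ε a : ℝ} (hρ : ‖ξ‖ = ρ) (hρ0 : 0 < ρ)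
    (hε : ε ≤ 1 / 2) (hε' : ε ≤ a ^ 3 * ρ) (ha : 1 ≤ a) (hβξ : ‖β - ξ‖ ≤ ε * ρ)
    (heβ : ‖e - β‖ ≤ ε * ‖β‖) (hin : inner ℝ ξ e = ‖β‖ ^ 2) :
    ‖β‖ ≤ 3 / 2 * ρ ∧ ρ / 2 ≤ ‖β‖ ∧ ρ / 4 ≤ ‖e‖ ∧
      ‖e‖ ^ 2 * ρ ^ 2 - ‖β‖ ^ 4 ≤ ρ ^ 2 * (25 / 8 * a ^ 3 * ρ ^ 3) := by
  have ha3 : 0 ≤ a ^ 3 := by positivity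
  have hε0 : 0 ≤ ε := nonneg_of_mul_nonneg_left ((norm_nonneg _).trans hβξ) hρ0
  have hβ1 : ‖β‖ ≤ 3 / 2 * ρ := by
    have := norm_le_norm_add_norm_sub' β ξ
    nlinarith
  have hβ2 : ρ / 2 ≤ ‖β‖ := by
    have := norm_le_norm_add_norm_sub' ξ β
    rw [norm_sub_rev] at this
    nlinarith
  have he : ρ / 4 ≤ ‖e‖ := by
    have := norm_le_norm_add_norm_sub' β e
    rw [norm_sub_rev] at this
    nlinarith
  have heξ : ‖e - ξ‖ ≤ 5 / 2 * ε * ρ := by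
    have h1 : ‖e - ξ‖ ≤ ‖e - β‖ + ‖β - ξ‖ := norm_sub_le_norm_sub_add_norm_sub _ _ _
    nlinarith
  -- Lagrange's identity bounds the part of `e` orthogonal to `ξ`
  have hgram : ‖e‖ ^ 2 * ρ ^ 2 - ‖β‖ ^ 4 ≤ ρ ^ 2 * (25 / 8 * a ^ 3 * ρ ^ 3) := by
    have h1 : ‖e - ξ‖ ^ 2 = ‖e‖ ^ 2 - 2 * ‖β‖ ^ 2 + ρ ^ 2 := by
      rw [norm_sub_sq_real, real_inner_comm, hin, hρ]
    have h2 : ‖e - ξ‖ ^ 2 ≤ (5 / 2 * ε * ρ) ^ 2 := by gcongr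
    have h3 : (5 / 2 * ε * ρ) ^ 2 ≤ 25 / 8 * a ^ 3 * ρ ^ 3 := by
      have : ε * ε ≤ 1 / 2 * (a ^ 3 * ρ) := mul_le_mul hε hε' hε0 (by norm_num)
      have := mul_le_mul_of_nonneg_right this (sq_nonneg ρ)
      linarith
    have h4 := mul_le_mul_of_nonneg_left (h2.trans h3) (sq_nonneg ρ)
    have h5 : ‖e‖ ^ 2 * ρ ^ 2 - ‖β‖ ^ 4 = ρ ^ 2 * ‖e - ξ‖ ^ 2 - (‖β‖ ^ 2 - ρ ^ 2) ^ 2 := by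
      rw [h1]; ring
    linarith [sq_nonneg (‖β‖ ^ 2 - ρ ^ 2)]
  exact ⟨hβ1, hβ2, he, hgram⟩

/-- The scalar inequality behind the cone barriers. -/
theorem cone_inequality {nβ ne ρ s l h Q b T a B : ℝ}
    (hρ0 : 0 < ρ) (ha : 1 ≤ a) (hβ1 : nβ ≤ 3 / 2 * ρ) (hβ2 : ρ / 2 ≤ nβ) (he : ρ / 4 ≤ ne)
    (hgram : ne ^ 2 * ρ ^ 2 - nβ ^ 4 ≤ ρ ^ 2 * (25 / 8 * a ^ 3 * ρ ^ 3))
    (hs : 4 ≤ s) (hl : 0 ≤ l) (hlρ : l * ρ ≤ 1 / 4) (hh : h = s * (ρ⁻¹ - 2 * l))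
    (hQ : Q ≤ a ^ 3 * h * nβ ^ 2 * ρ) (hB : 0 ≤ B) (hb : |b| ≤ B * h * nβ)
    (hT : T = h ^ 2 * (-(s / ρ ^ 3) * nβ ^ 4 + h * ne ^ 2 + Q) +
      (h * nβ) ^ 2 * b * Real.log (h * nβ))
    (hlB : 8 * (7 * a ^ 3 + 4 * a ^ 3 + 8 * B * Real.log (2 * s)) < l) : T < 0 := by
  have ha3 : 0 ≤ a ^ 3 := by positivity
  have hnβ : 0 < nβ := by linarith
  have hhρ : h * ρ = s * (1 - 2 * (l * ρ)) := by rw [hh]; field_simp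
  have hh0 : 0 < h := by
    have : 0 < h * ρ := by rw [hhρ]; apply mul_pos <;> linarith
    exact pos_of_mul_pos_left this hρ0.le
  have hhρ1 : h * ρ ≤ s := by rw [hhρ]; nlinarith [mul_nonneg hl hρ0.le]
  have hhρ2 : s / 2 ≤ h * ρ := by rw [hhρ]; nlinarith
  have hmain : -(s / ρ ^ 3) * nβ ^ 4 + h * ne ^ 2 ≤
      s * ρ ^ 2 * (25 / 8 * a ^ 3) - s * ρ ^ 2 * (l / 8) := by
    -- The slope contributes only the Gram-type difference, which vanishes when `β = e = ξ`. The
    -- curvature gain `2 l s ne²` is left, and `ne ≥ ρ / 4` turns it into `s ρ² l / 8`.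
    have h1 : -(s / ρ ^ 3) * nβ ^ 4 + h * ne ^ 2 =
        s / ρ ^ 3 * (ne ^ 2 * ρ ^ 2 - nβ ^ 4) - 2 * l * s * ne ^ 2 := by
      rw [hh]; field_simp; ring
    have h2 : s / ρ ^ 3 * (ne ^ 2 * ρ ^ 2 - nβ ^ 4) ≤
        s / ρ ^ 3 * (ρ ^ 2 * (25 / 8 * a ^ 3 * ρ ^ 3)) := by gcongr
    have h3 : s / ρ ^ 3 * (ρ ^ 2 * (25 / 8 * a ^ 3 * ρ ^ 3)) = s * ρ ^ 2 * (25 / 8 * a ^ 3) := by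
      field_simp
    have h4 : (ρ / 4) ^ 2 ≤ ne ^ 2 := by gcongr
    have h5 : 2 * l * s * (ρ / 4) ^ 2 ≤ 2 * l * s * ne ^ 2 := by gcongr
    rw [h1]
    linarith
  have hβsq : nβ ^ 2 ≤ 9 / 4 * ρ ^ 2 := by
    calc nβ ^ 2 ≤ (3 / 2 * ρ) ^ 2 := by gcongr
      _ = _ := by ring
  have hQ' : Q ≤ s * ρ ^ 2 * (9 / 4 * a ^ 3) := by
    calc Q ≤ a ^ 3 * (h * ρ) * nβ ^ 2 := hQ.trans (by linarith)
      _ ≤ a ^ 3 * s * (9 / 4 * ρ ^ 2) := by gcongr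
      _ = _ := by ring
  -- The gradient has norm at least `s / 4 ≥ 1`, so its logarithm is nonnegative and `b` may be
  -- replaced by its upper bound.
  have hlog0 : 1 ≤ h * nβ := by
    have := mul_le_mul_of_nonneg_left hβ2 hh0.le
    linarith
  have hhβ : h * nβ ≤ 3 / 2 * s := by
    have := mul_le_mul_of_nonneg_left hβ1 hh0.le
    linarith
  have hlog1 : Real.log (h * nβ) ≤ Real.log (2 * s) :=
    Real.log_le_log (by linarith) (by linarith)
  have hlog2 : 0 ≤ Real.log (h * nβ) := Real.log_nonneg hlog0
  have hlast : (h * nβ) ^ 2 * b * Real.log (h * nβ) ≤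
      h ^ 2 * (s * ρ ^ 2 * (27 / 8 * B * Real.log (2 * s))) := by
    calc (h * nβ) ^ 2 * b * Real.log (h * nβ)
        ≤ (h * nβ) ^ 2 * (B * h * nβ) * Real.log (2 * s) := by
          gcongr
          exact (le_abs_self b).trans hb
      _ = h ^ 2 * (nβ ^ 2 * (B * (h * nβ) * Real.log (2 * s))) := by ring
      _ ≤ h ^ 2 * (9 / 4 * ρ ^ 2 * (B * (3 / 2 * s) * Real.log (2 * s))) := by
          have := hlog2.trans hlog1
          gcongr
      _ = _ := by ring
  have hlogs : 0 ≤ B * Real.log (2 * s) := mul_nonneg hB (hlog2.trans hlog1)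
  have hfin : T ≤ h ^ 2 * (s * ρ ^ 2 * (25 / 8 * a ^ 3 + 9 / 4 * a ^ 3 +
      27 / 8 * B * Real.log (2 * s) - l / 8)) := by
    rw [hT]
    have := mul_le_mul_of_nonneg_left (add_le_add hmain hQ') (sq_nonneg h)
    linarith
  refine hfin.trans_lt (mul_neg_of_pos_of_neg (by positivity)
    (mul_neg_of_pos_of_neg (by positivity) ?_))
  nlinarith
-- The operator `A = coframe y ∘ synth x` differs from the identity by at most `a³ ‖ξ‖`, one factor
-- `a` each from `coframe`, the Lipschitz bound and `‖x - y‖ ≤ a ‖ξ‖`. This closeness supplies the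
-- hypotheses of `cone_geometry` and `cone_inequality`.
theorem infLaplace_cone_neg {X : Frame n} {K : Set (Space n)} {a : ℝ} (hK : X.Bounds K a)
    {x y : Space n} (hx : x ∈ K) (hy : y ∈ K) (hxy : x ≠ y) {p : Space n → ℝ} {s l B : ℝ} (c : ℝ)
    (hB : ‖X.grad (fun z => Real.log (p z)) x‖ ≤ B) (hs : 4 ≤ s) (hl : 0 ≤ l)
    (haρ : a ^ 3 * ‖X.coframe y (x - y)‖ ≤ 1 / 2) (hlρ : l * ‖X.coframe y (x - y)‖ ≤ 1 / 4)
    (hlB : 8 * (7 * a ^ 3 + 4 * a ^ 3 + 8 * B * Real.log (2 * s)) < l) :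
    X.infLaplace p x (X.grad (fun z => c + X.cone y s l z) x,
      X.symHess (fun z => c + X.cone y s l z) x) < 0 := by
  have hsub : x - y = X.synth y (X.coframe y (x - y)) := (X.synth_coframe _ _).symm
  have h0 : X.coframe y (x - y) ≠ 0 := fun h => hxy (by rwa [h, map_zero, sub_eq_zero] at hsub)
  obtain ⟨ξ, hξ⟩ : ∃ ξ, ξ = X.coframe y (x - y) := ⟨_, rfl⟩
  rw [← hξ] at haρ hlρ hsub
  have hρ0 : 0 < ‖ξ‖ := norm_pos_iff.2 (hξ ▸ h0)
  have ha := hK.one_le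
  have ha0 : 0 ≤ a := by linarith
  set β := ContinuousLinearMap.adjoint ((X.coframe y).comp (X.synth x)) ξ with hβdef
  have hβ : ∀ c, inner ℝ β c = inner ℝ ξ (X.coframe y (X.synth x c)) := fun c => by
    rw [hβdef, ContinuousLinearMap.adjoint_inner_left]; rfl
  have hN : ∀ c, ‖X.coframe y (X.synth x c) - c‖ ≤ a ^ 3 * ‖ξ‖ * ‖c‖ := fun c => by
    have h1 : X.coframe y (X.synth x c) - c = X.coframe y (X.synth x c - X.synth y c) := by
      rw [map_sub, coframe_synth]
    have h2 : ‖x - y‖ ≤ a * ‖ξ‖ := by rw [hsub]; exact hK.synth_le y hy ξ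
    calc ‖X.coframe y (X.synth x c) - c‖ ≤ a * (a * ‖x - y‖ * ‖c‖) := by
          rw [h1]
          refine (hK.coframe_le y hy _).trans ?_
          gcongr
          exact hK.sub_le x hx y hy c
      _ ≤ a * (a * (a * ‖ξ‖) * ‖c‖) := by gcongr
      _ = a ^ 3 * ‖ξ‖ * ‖c‖ := by ring
  -- The adjoint inherits the bound on `A - 1`: pair `A* ξ - ξ` with itself and divide by its norm.
  have hβξ : ‖β - ξ‖ ≤ a ^ 3 * ‖ξ‖ * ‖ξ‖ := by
    have h1 : ‖β - ξ‖ * ‖β - ξ‖ ≤ a ^ 3 * ‖ξ‖ * ‖ξ‖ * ‖β - ξ‖ := by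
      calc ‖β - ξ‖ * ‖β - ξ‖
          = inner ℝ ξ (X.coframe y (X.synth x (β - ξ)) - (β - ξ)) := by
            rw [inner_sub_right, ← hβ, ← inner_sub_left, real_inner_self_eq_norm_mul_norm]
        _ ≤ ‖ξ‖ * (a ^ 3 * ‖ξ‖ * ‖β - ξ‖) :=
            (real_inner_le_norm _ _).trans (by gcongr; exact hN _)
        _ = _ := by ring
    rcases (norm_nonneg (β - ξ)).eq_or_lt with h | h
    · rw [← h]; positivity
    · exact le_of_mul_le_mul_right h1 h
  obtain ⟨hβ1, hβ2, he, hgram⟩ := cone_geometry rfl hρ0 haρ le_rfl ha hβξ (hN β)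
    (by rw [← hβ, real_inner_self_eq_norm_sq])
  obtain ⟨hgrad, hhess⟩ := X.dotProduct_symHess_cone s l c h0 hξ hβ rfl rfl
  have hh0 : 0 ≤ s * (‖ξ‖⁻¹ - 2 * l) := by
    refine mul_nonneg (by linarith) (sub_nonneg.2 ?_)
    rw [inv_eq_one_div, le_div_iff₀ hρ0]
    linarith
  set h := s * (‖ξ‖⁻¹ - 2 * l) with hh
  refine cone_inequality hρ0 ha hβ1 hβ2 he hgram hs hl hlρ hh (B := B)
    (b := inner ℝ (h • β) (X.grad (fun z => Real.log (p z)) x)) ?_ ((norm_nonneg _).trans hB) ?_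
    ?_ hlB (Q := inner ℝ ξ
      (X.coframe y (∑ i, β i • fderiv ℝ (X.field i) x (X.synth x (h • β)))))
  · calc _ ≤ ‖ξ‖ * (a * (a * ‖β‖ * (a * ‖h • β‖))) := by
          refine (real_inner_le_norm _ _).trans ?_
          gcongr
          refine (hK.coframe_le y hy _).trans ?_
          gcongr
          refine (hK.fderiv_le x hx _ _).trans ?_
          gcongr
          exact hK.synth_le x hx _
      _ = a ^ 3 * h * ‖β‖ ^ 2 * ‖ξ‖ := by
          rw [norm_smul, Real.norm_of_nonneg hh0]; ring
  · calc _ ≤ ‖h • β‖ * B := (abs_real_inner_le_norm _ _).trans (by gcongr)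
      _ = B * h * ‖β‖ := by rw [norm_smul, Real.norm_of_nonneg hh0]; ring
  · rw [infLaplace]
    simp only
    rw [hgrad, hhess, norm_smul, Real.norm_of_nonneg hh0]

/-! ### Comparison with cones. -/

/-- A positive superharmonic function lies above the cone of height `u y + r` with vertex `y`. -/
theorem half_le_of_isSuperharmonic {X : Frame n} {K Ω : Set (Space n)} {a B : ℝ}
    (hK : X.Bounds K a) {p u : Space n → ℝ}
    (hp : ∀ x ∈ Ω, ‖X.grad (fun z => Real.log (p z)) x‖ ≤ B) (hu : X.IsSuperharmonic p Ω u)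
    (hpos : ∀ x ∈ Ω, 0 < u x) {y : Space n} (hy : y ∈ K) {r R l : ℝ} (hr : 0 < r) (hR : 0 < R)
    (hE : ∀ x, ‖X.coframe y (x - y)‖ ≤ R → x ∈ Ω ∩ K) (hRr : 2 * R ≤ r)
    (hl : 0 ≤ l) (haR : a ^ 3 * R ≤ 1 / 2) (hlR : l * R ≤ 1 / 4)
    (hlB : 8 * (7 * a ^ 3 + 4 * a ^ 3 + 8 * B * Real.log (2 * (2 * (u y + r) / R))) < l)
    {z : Space n} (hz : ‖X.coframe y (z - y)‖ ≤ R / 4) : (u y + r) / 2 ≤ u z + r := by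
  have ha := hK.one_le
  set E := {x | ‖X.coframe y (x - y)‖ ≤ R} with hEdef
  have hcont : Continuous fun x => ‖X.coframe y (x - y)‖ := by fun_prop
  have hyE : y ∈ E := by simp [hEdef, hR.le]
  have hEc : IsCompact E := by
    refine Metric.isCompact_of_isClosed_isBounded (isClosed_le hcont continuous_const) ?_
    refine (Metric.isBounded_closedBall (x := y) (r := a * R)).subset fun x hx => ?_
    rw [mem_closedBall_iff_norm, ← X.synth_coframe y (x - y)]
    exact (hK.synth_le y hy _).trans (by gcongr; exact hx)
  have huy := hpos y (hE y hyE).1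
  set s := 2 * (u y + r) / R with hs
  have hsR : s * R = 2 * (u y + r) := by rw [hs]; field_simp
  have hs4 : 4 ≤ s := by
    rw [hs, le_div_iff₀ hR]; linarith
  have hcone : Continuous (X.cone y s l) := by unfold cone; fun_prop
  have hlsc : LowerSemicontinuousOn (fun x => u x + X.cone y s l x) E :=
    (hu.1.mono fun x hx => (hE x hx).1).add hcone.continuousOn.lowerSemicontinuousOn
  obtain ⟨x, hxE, hmin⟩ := hlsc.exists_isMinOn ⟨y, hyE⟩ hEc
  have hle : ∀ w ∈ E, u x + X.cone y s l x ≤ u w + X.cone y s l w := fun w hw => hmin hw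
  have hcy : X.cone y s l y = 0 := by simp [cone]
  have key : u y ≤ u x + X.cone y s l x := by
    by_contra! hlt
    have hxy : x ≠ y := by
      rintro rfl
      simp [hcy] at hlt
    have hxΩ := hE x hxE
    have hlt' : ‖X.coframe y (x - y)‖ < R := by
      -- On the boundary the cone equals `2 (u y + r) (1 - l R) ≥ 3/2 (u y + r)`, which with `u > 0`
      -- rules out a value below `u y`.
      refine lt_of_le_of_ne hxE fun h => ?_
      have h1 : X.cone y s l x = s * R * (1 - l * R) := by rw [cone, h]; ring
      rw [hsR] at h1
      have := hpos x hxΩ.1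
      nlinarith
    have hev : ∀ᶠ w in 𝓝 x, -u w ≤ (-(u x + X.cone y s l x)) + X.cone y s l w := by
      filter_upwards [hcont.continuousAt.eventually_lt continuousAt_const hlt'] with w hw
      linarith [hle w hw.le]
    obtain ⟨c, hc⟩ : ∃ c, c = -(u x + X.cone y s l x) := ⟨_, rfl⟩
    rw [← hc] at hev
    set q := (X.grad (fun z => c + X.cone y s l z) x, X.symHess (fun z => c + X.cone y s l z) x)
      with hq
    have hsup : q ∈ X.superjet (fun w => -u w) x :=
      ⟨fun z => c + X.cone y s l z, contDiffAt_const.add (X.contDiffAt_cone s l hxy),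
        by rw [hc]; ring, hev, rfl⟩
    have hsub : -q ∈ X.subjet u x := by
      change - -q ∈ X.superjet (fun w => -u w) x
      rwa [neg_neg]
    have h1 := hu.2 x hxΩ.1 (-q) ⟨fun _ => x, fun _ => -q, fun _ => hsub, tendsto_const_nhds,
      tendsto_const_nhds, tendsto_const_nhds⟩
    -- The operator is odd in the jet, since the logarithm depends only on the norm of the gradient.
    have h2 : -X.infLaplace p x (-q) = X.infLaplace p x q := by
      simp [infLaplace, Matrix.neg_mulVec, Matrix.mulVec_neg]
      ring
    have h3 : X.infLaplace p x q < 0 := infLaplace_cone_neg hK hxΩ.2 hy hxy c (hp x hxΩ.1) hs4 hl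
      ((mul_le_mul_of_nonneg_left hxE (by positivity)).trans haR)
      ((mul_le_mul_of_nonneg_left hxE hl).trans hlR) hlB
    linarith
  have hzE : z ∈ E := hz.trans (by linarith)
  have h1 := key.trans (hle z hzE)
  have h2 : X.cone y s l z ≤ s * (R / 4) := by
    unfold cone
    refine mul_le_mul_of_nonneg_left ?_ (by linarith)
    nlinarith [mul_nonneg hl (sq_nonneg ‖X.coframe y (z - y)‖)]
  linarith

/-! ### Harnack chains and the choice of constants. -/

theorem IsCurve.norm_sub_le {X : Frame n} {K : Set (Space n)} {a : ℝ} (hK : X.Bounds K a)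
    {x y : Space n} {γ c : ℝ → Space n} (h : X.IsCurve x y γ c)
    (hγ : ∀ t ∈ Set.Icc (0 : ℝ) 1, γ t ∈ K) {t t' : ℝ} (h0 : 0 ≤ t') (h1 : t' ≤ t) (h2 : t ≤ 1) :
    ‖γ t - γ t'‖ ≤ a * ∫ τ in t'..t, ‖c τ‖ := by
  have hsub : Set.Icc t' t ⊆ Set.Icc 0 1 := Set.Icc_subset_Icc h0 h2
  have hc' : ContinuousOn (fun τ => X.synth (γ τ) (c τ)) (Set.uIcc t' t) := by
    rw [Set.uIcc_of_le h1]
    exact ((X.continuous_synth.comp_continuousOn h.continuousOn).clm_apply h.2.2.1).mono hsub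
  have hcn : IntervalIntegrable (fun τ => a * ‖c τ‖) MeasureTheory.volume t' t := by
    refine ContinuousOn.intervalIntegrable ?_
    rw [Set.uIcc_of_le h1]
    exact (continuousOn_const.mul h.2.2.1.norm).mono hsub
  have hftc := intervalIntegral.integral_eq_sub_of_hasDerivAt_of_le h1
    (h.continuousOn.mono hsub) (fun τ hτ => by
      have := h.2.2.2 τ (hsub (Set.Ioo_subset_Icc_self hτ))
      rw [← synth_apply] at this
      exact this.hasDerivAt (Icc_mem_nhds (by linarith [hτ.1]) (by linarith [hτ.2])))
    hc'.intervalIntegrable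
  rw [← hftc, ← intervalIntegral.integral_const_mul]
  refine intervalIntegral.norm_integral_le_of_norm_le h1 ?_ hcn
  refine Eventually.of_forall fun τ hτ => hK.synth_le _ (hγ τ (hsub (Set.Ioc_subset_Icc_self hτ))) _

/-- A Harnack chain along a curve. -/
theorem harnack_chain {X : Frame n} {K : Set (Space n)} {a : ℝ} (hK : X.Bounds K a)
    {x y : Space n} {r δ : ℝ} {N : ℕ} {v : Space n → ℝ} (hr : 0 < r) (hδ : 0 < δ)
    (hball : X.ball x r ⊆ K)
    (hstep : ∀ y ∈ X.ball x r, ∀ z ∈ X.ball x r, ‖z - y‖ ≤ δ * r → v y / 2 ≤ v z)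
    (hN : a ≤ N * δ) (hy : y ∈ X.ball x r) : v x ≤ 2 ^ N * v y ∧ v y ≤ 2 ^ N * v x := by
  obtain ⟨γ, c, hγ, hl⟩ := X.exists_isCurve_of_mem_ball hy
  have ha := hK.one_le
  have ha0 : 0 < a := by linarith
  have hmem : ∀ t ∈ Set.Icc (0 : ℝ) 1, γ t ∈ X.ball x r := fun t ht => hγ.mem_ball hl ht
  have hint : ∀ s ∈ Set.Icc (0 : ℝ) 1, ∀ t ∈ Set.Icc (0 : ℝ) 1,
      IntervalIntegrable (fun τ => ‖c τ‖) MeasureTheory.volume s t := fun s hs t ht =>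
    (hγ.2.2.1.norm.mono (Set.ordConnected_Icc.uIcc_subset hs ht)).intervalIntegrable
  have h00 : (0 : ℝ) ∈ Set.Icc (0 : ℝ) 1 := by simp
  set S : ℝ → ℝ := fun t => ∫ τ in (0 : ℝ)..t, ‖c τ‖ with hS
  have hScont : ContinuousOn S (Set.Icc 0 1) := by
    have := intervalIntegral.continuousOn_primitive_interval (a := (0 : ℝ)) (b := 1)
      (f := fun τ => ‖c τ‖) (μ := MeasureTheory.volume)
      (by simpa using (hγ.2.2.1.norm.integrableOn_compact isCompact_Icc))
    simpa using this
  have hdiff : ∀ t' t, 0 ≤ t' → t' ≤ t → t ≤ 1 → ‖γ t - γ t'‖ ≤ a * (S t - S t') :=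
    fun t' t h0 h1 h2 => by
      have h := hγ.norm_sub_le hK (fun t ht => hball (hmem t ht)) h0 h1 h2
      rwa [← intervalIntegral.integral_interval_sub_left (hint 0 h00 t ⟨h0.trans h1, h2⟩)
        (hint 0 h00 t' ⟨h0, h1.trans h2⟩)] at h
  have hS0 : S 0 = 0 := by simp [hS]
  have hind : ∀ k : ℕ, ∀ t ∈ Set.Icc (0 : ℝ) 1, S t ≤ k * (δ * r / a) →
      v x ≤ 2 ^ k * v (γ t) ∧ v (γ t) ≤ 2 ^ k * v x := by
    -- Induction on arc length: each step goes back by `δ r / a` in length, hence by at most `δ r`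
    -- in Euclidean distance.
    intro k
    induction k with
    | zero =>
      intro t ht hSt
      have h := hdiff 0 t le_rfl ht.1 ht.2
      rw [hS0, hγ.1] at h
      have h' : γ t = x := by
        rw [← sub_eq_zero, ← norm_le_zero_iff]
        refine h.trans (mul_nonpos_of_nonneg_of_nonpos ha0.le ?_)
        simpa using hSt
      simp [h']
    | succ k ih =>
      intro t ht hSt
      have hStn : 0 ≤ S t := intervalIntegral.integral_nonneg ht.1 fun _ _ => norm_nonneg _
      have hσ : 0 < δ * r / a := by positivity
      obtain ⟨t', ht', hSt'⟩ := intermediate_value_Icc ht.1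
        (hScont.mono (Set.Icc_subset_Icc_right ht.2))
        (show max (S t - δ * r / a) 0 ∈ Set.Icc (S 0) (S t) by
          rw [hS0]
          exact ⟨le_max_right _ _, max_le (by linarith) hStn⟩)
      have ht1 : t' ∈ Set.Icc (0 : ℝ) 1 := ⟨ht'.1, ht'.2.trans ht.2⟩
      push_cast at hSt
      have hk : S t' ≤ k * (δ * r / a) := by
        rw [hSt']
        exact max_le (by linarith) (by positivity)
      have hd : ‖γ t - γ t'‖ ≤ δ * r := by
        refine (hdiff t' t ht'.1 ht'.2 ht.2).trans ?_
        have : S t - S t' ≤ δ * r / a := by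
          rw [hSt']; linarith [le_max_left (S t - δ * r / a) 0]
        calc a * (S t - S t') ≤ a * (δ * r / a) := by gcongr
          _ = δ * r := by field_simp
      obtain ⟨i1, i2⟩ := ih t' ht1 hk
      have j1 := hstep _ (hmem t' ht1) _ (hmem t ht) hd
      have j2 := hstep _ (hmem t ht) _ (hmem t' ht1) (by rwa [norm_sub_rev])
      have h2k : (0 : ℝ) < 2 ^ k := by positivity
      rw [pow_succ]
      constructor
      · nlinarith
      · nlinarith
  have h := hind N 1 (by simp) (by
    have h1 : r ≤ N * (δ * r / a) := by
      have : N * (δ * r / a) = N * δ * r / a := by ring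
      rw [this, le_div_iff₀ ha0]
      nlinarith
    exact hl.le.trans h1)
  rwa [hγ.2.1] at h

/-- The function `r log r` is continuous and vanishes at 0, so a curvature that grows like `log (1 /
r)` is still small against `1 / r`. -/
theorem exists_small_radius (c₁ c₂ : ℝ) :
    ∃ r₀ : ℝ, 0 < r₀ ∧ r₀ ≤ 1 ∧ ∀ r, 0 < r → r ≤ r₀ → r * (c₁ - c₂ * Real.log r) ≤ 1 / 4 := by
  have hc : Continuous fun r : ℝ => r * c₁ - c₂ * (r * Real.log r) :=
    (continuous_id.mul continuous_const).sub (continuous_const.mul Real.continuous_mul_log)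
  have h0 : ∀ᶠ r in 𝓝 (0 : ℝ), r * c₁ - c₂ * (r * Real.log r) < 1 / 4 :=
    hc.continuousAt.eventually_lt continuousAt_const (by norm_num)
  obtain ⟨ε, hε, h⟩ := Metric.eventually_nhds_iff.1 h0
  refine ⟨min (ε / 2) 1, by positivity, min_le_right _ _, fun r hr hr' => ?_⟩
  have h1 := @h r (by
    rw [Real.dist_eq, sub_zero, abs_of_pos hr]
    linarith [hr'.trans (min_le_left _ _)])
  linarith

/-- The Harnack inequality between two points of a small ball. -/
theorem harnack_of_small_radius {X : Frame n} {Ω : Set (Space n)} (hΩ : IsBoundedDomain Ω)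
    {p : Space n → ℝ} (hp : X.IsExponent Ω p) (M : ℝ) :
    ∃ (r₀ : ℝ) (N : ℕ), 0 < r₀ ∧ ∀ u : Space n → ℝ, X.IsSuperharmonic p Ω u →
      (∀ x ∈ Ω, 0 < u x) → ∀ (x₀ : Space n) (r : ℝ), 0 < r → r ≤ r₀ → X.ball x₀ (2 * r) ⊆ Ω →
        (∀ x ∈ X.ball x₀ (2 * r), u x ≤ M) → ∀ y ∈ X.ball x₀ r,
          u x₀ + r ≤ 2 ^ N * (u y + r) ∧ u y + r ≤ 2 ^ N * (u x₀ + r) := by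
  obtain ⟨hopen, -, hbdd⟩ := hΩ
  obtain ⟨hp1, hp2, B, hB⟩ := hp
  obtain ⟨R₀, hR₀⟩ := hbdd.subset_closedBall 0
  obtain ⟨a, ha⟩ := X.exists_bounds (R₀ + 1)
  set K := Metric.closedBall (0 : Space n) (R₀ + 1)
  have hΩK : ∀ q ∈ Ω, ∀ v : Space n, ‖v‖ ≤ 1 → q + v ∈ K := fun q hq v hv => by
    have h1 := hR₀ hq
    rw [mem_closedBall_zero_iff] at h1 ⊢
    exact (norm_add_le _ _).trans (add_le_add h1 hv)
  have hΩK' : Ω ⊆ K := fun q hq => by simpa using hΩK q hq 0 (by simp)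
  have hlog : ∀ x ∈ Ω, ‖X.grad (fun z => Real.log (p z)) x‖ ≤ |B| := fun x hx =>
    norm_grad_log_le ((hp1.contDiffAt (hopen.mem_nhds hx)).differentiableAt (by simp)) (hp2 x hx)
      ((hB x hx).2.trans (le_abs_self B))
  have ha1 := ha.one_le
  have ha0 : 0 < a := by linarith
  have ha3 : 1 ≤ a ^ 3 := one_le_pow₀ ha1
  -- The two constants expand the curvature `l` chosen below, after `L` is bounded by `log (8 a³
  -- (|M| + 1)) - log r`.
  obtain ⟨r₀, hr₀, hr₀1, hsmall⟩ := exists_small_radius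
    (88 * a ^ 3 + 1 + 64 * |B| * Real.log (8 * a ^ 3 * (|M| + 1))) (64 * |B|)
  refine ⟨r₀, ⌈8 * a ^ 5⌉₊, hr₀, fun u hu hpos x₀ r hr hrr hball hM y hy => ?_⟩
  -- A Euclidean step `δ r` has frozen norm at most `a δ r = R / 4` for `R = r / (2 a³)`, and `a / δ
  -- = 8 a⁵` gives the number of steps.
  refine harnack_chain (v := fun x => u x + r) (δ := 1 / (8 * a ^ 4)) ha hr (by positivity)
    (((X.ball_mono x₀ (by linarith)).trans hball).trans hΩK') ?_ ?_ hy
  · intro y hy z _ hzy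
    set R := r / (2 * a ^ 3) with hR
    have hR0 : 0 < R := by positivity
    have haR : a ^ 3 * R = r / 2 := by rw [hR]; field_simp
    have hRr : 2 * R ≤ r := by nlinarith
    have hyΩ : y ∈ Ω := hball (X.ball_mono x₀ (by linarith) hy)
    have huy := hpos y hyΩ
    have hyM : u y ≤ |M| :=
      (hM y (X.ball_mono x₀ (by linarith) hy)).trans (le_abs_self M)
    have hlog1 : Real.log (2 * (2 * (u y + r) / R)) ≤
        Real.log (8 * a ^ 3 * (|M| + 1)) - Real.log r := by
      rw [← Real.log_div (by positivity) hr.ne']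
      refine Real.log_le_log (by positivity) ?_
      have : 2 * (2 * (u y + r) / R) = 8 * a ^ 3 * (u y + r) / r := by
        rw [hR]; field_simp; ring
      rw [this]
      gcongr
      linarith
    have hlog0 : 0 ≤ Real.log (2 * (2 * (u y + r) / R)) := by
      refine Real.log_nonneg ?_
      have : 1 ≤ 2 * (u y + r) / R := by rw [le_div_iff₀ hR0]; linarith
      linarith
    set L := Real.log (2 * (2 * (u y + r) / R)) with hL
    have hBL : |B| * L ≤ |B| * (Real.log (8 * a ^ 3 * (|M| + 1)) - Real.log r) := by gcongr
    -- The added 1 makes the lower bound on the curvature strict.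
    refine half_le_of_isSuperharmonic (l := 8 * (7 * a ^ 3 + 4 * a ^ 3 + 8 * |B| * L) + 1)
      ha hlog hu hpos (hΩK' hyΩ) hr hR0 ?_ hRr (by positivity) (by linarith) ?_
      (by linarith) ?_
    · intro x hx
      have h1 : ‖x - y‖ ≤ a * R := by
        rw [← X.synth_coframe y (x - y)]
        exact (ha.synth_le y (hΩK' hyΩ) _).trans (by gcongr)
      have h3 : a ^ 2 * ‖x - y‖ ≤ r / 2 := by
        rw [← haR]
        calc a ^ 2 * ‖x - y‖ ≤ a ^ 2 * (a * R) := by gcongr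
          _ = a ^ 3 * R := by ring
      have h4 : a * ‖x - y‖ ≤ a ^ 2 * ‖x - y‖ := by
        gcongr
        nlinarith
      have h5 : ‖x - y‖ ≤ a * ‖x - y‖ := le_mul_of_one_le_left (norm_nonneg _) ha1
      have hxΩ : x ∈ Ω := hball (mem_ball_of_norm_sub_le ha
        ((X.ball_mono x₀ (by linarith)).trans hball) hΩK hy (by linarith) (by linarith)
        (by linarith))
      exact ⟨hxΩ, hΩK' hxΩ⟩
    · have h1 := hsmall r hr hrr
      have h2 : R ≤ r := by linarith
      have h3 : 0 ≤ 8 * (7 * a ^ 3 + 4 * a ^ 3 + 8 * |B| * L) + 1 := by positivity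
      have h4 := mul_le_mul_of_nonneg_left h2 h3
      have h5 := mul_le_mul_of_nonneg_left hBL hr.le
      linarith
    · refine (ha.coframe_le y (hΩK' hyΩ) _).trans ?_
      calc a * ‖z - y‖ ≤ a * (1 / (8 * a ^ 4) * r) := by gcongr
        _ = R / 4 := by rw [hR]; field_simp; norm_num
  · calc a = 8 * a ^ 5 * (1 / (8 * a ^ 4)) := by field_simp
      _ ≤ ⌈8 * a ^ 5⌉₊ * (1 / (8 * a ^ 4)) := by gcongr; exact Nat.le_ceil _

end Frame

end FrameHarnack

end

theorem theorem4p2 (n : ℕ) (X : FrameHarnack.Frame n)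
    (Ω : Set (FrameHarnack.Space n)) (hΩ : FrameHarnack.IsBoundedDomain Ω)
    (p : FrameHarnack.Space n → ℝ) (hp : X.IsExponent Ω p) (M : ℝ) :
    ∃ C : ℝ, 0 < C ∧
      ∀ u : FrameHarnack.Space n → ℝ, X.IsHarmonic p Ω u → (∀ x ∈ Ω, 0 < u x) →
        ∀ (x₀ : FrameHarnack.Space n) (r : ℝ), 0 < r → X.ball x₀ (2 * r) ⊆ Ω →
          IsLUB (u '' X.ball x₀ (2 * r)) M →
            sSup (u '' X.ball x₀ r) ≤ C * (sInf (u '' X.ball x₀ r) + r) := by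
  obtain ⟨r₀, N, hr₀, hH⟩ := FrameHarnack.Frame.harnack_of_small_radius hΩ hp M
  refine ⟨2 ^ N * 2 ^ N + |M| / r₀, by positivity, fun u hu hpos x₀ r hr hball hM => ?_⟩
  set C := 2 ^ N * 2 ^ N + |M| / r₀ with hC
  have hC0 : 0 < C := by positivity
  have hsub : X.ball x₀ r ⊆ X.ball x₀ (2 * r) := X.ball_mono x₀ (by linarith)
  have hne : (u '' X.ball x₀ r).Nonempty := ⟨_, x₀, X.mem_ball_self x₀ hr, rfl⟩
  have hMle : ∀ x ∈ X.ball x₀ (2 * r), u x ≤ M := fun x hx => hM.1 ⟨x, hx, rfl⟩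
  have hxy : ∀ x ∈ X.ball x₀ r, ∀ y ∈ X.ball x₀ r, u x ≤ C * (u y + r) := by
    intro x hx y hy
    have huy := hpos y (hball (hsub hy))
    -- For small radii, two points are compared through the centre, which gives the square of `2 ^
    -- N`. For large radii, `|M| ≤ (|M| / r₀) r`.
    rcases le_total r r₀ with h | h
    · have h1 := (hH u hu.2 hpos x₀ r hr h hball hMle x hx).2
      have h2 := (hH u hu.2 hpos x₀ r hr h hball hMle y hy).1
      calc u x ≤ 2 ^ N * (u x₀ + r) := by linarith
        _ ≤ 2 ^ N * (2 ^ N * (u y + r)) := by gcongr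
        _ = 2 ^ N * 2 ^ N * (u y + r) := by ring
        _ ≤ C * (u y + r) := by
          gcongr
          rw [hC]
          exact le_add_of_nonneg_right (by positivity)
    · calc u x ≤ |M| := (hMle x (hsub hx)).trans (le_abs_self M)
        _ = |M| / r₀ * r₀ := by field_simp
        _ ≤ C * (u y + r) := by
          gcongr
          · rw [hC]
            exact le_add_of_nonneg_left (by positivity)
          · linarith
  have hinf : sSup (u '' X.ball x₀ r) / C - r ≤ sInf (u '' X.ball x₀ r) := by
    refine le_csInf hne ?_
    rintro _ ⟨y, hy, rfl⟩
    rw [sub_le_iff_le_add, div_le_iff₀' hC0]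
    refine csSup_le hne ?_
    rintro _ ⟨x, hx, rfl⟩
    exact hxy x hx y hy
  rw [sub_le_iff_le_add, div_le_iff₀' hC0] at hinf
  exact hinf
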